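/- Let $n\ge 1$ and let $T^n=S^1\times\cdots\times S^1$ be the $n$-torus with its global angular coordinates $(\theta_1,\dots,\theta_n)$. A smooth flow $\phi:\mathbb R\times T^n\to T^n$ is generated by the vector field $X(p)=\frac{d}{dt}\phi(t,p)\big|_{t=0}$. It is called quasiperiodic if there are a $C^\infty$ diffeomorphism $V$ of $T^n$ and a smooth flow generated by a constant vector field $Y=\sum_{i=1}^n b_i\,\partial/\partial\theta_i$, with $b_1,\dots,b_n\in\mathbb R$ linearly independent over $\mathbb Q$, such that $V_*X=Y$. The multiplier group of $\phi$ is the subgroup $$\rho_\phi(S_\phi)=\{\alpha\in\mathbb R^*:\ R_*X=\alpha X\ \text{for some } C^\infty \text{ diffeomorphism } R \text{ of } T^n\}$$ of $\mathbb R^*=\mathbb R\setminus\{0\}$, where $R_*X=\mathbf TR\circ X\circ R^{-1}$ is the push-forward of $X$ by $R$. Let $\phi$ be a quasiperiodic flow on $T^n$ generated by a constant vector field $X=\sum_{i=1}^n a_i\,\partial/\partial\theta_i$, $a_i\in\mathbb R$, and let $F\subset\mathbb R$ be a real algebraic number field of degree $n$ over $\mathbb Q$. Suppose that $\phi$ is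 $F$-algebraic, that is, there is a real $\vartheta\neq 0$ such that $\vartheta a_1,\dots,\vartheta a_n$ form a basis of $F$ over $\mathbb Q$. Then $\rho_\phi(S_\phi)$ is a subgroup of the group of units $\mathfrak o_F^*$ of the ring of integers $\mathfrak o_F$ of $F$ (as subgroups of $\mathbb R^*$). -/

import Mathlib

noncomputable section

open scoped Manifold ContDiff

namespace QuasiperiodicFlow

/-- The `n`-torus `S¹ × ⋯ × S¹`. -/
abbrev Torus (n : ℕ) : Type := Fin n → Circle

/-- The model with corners of the product manifold structure on the torus: the product of the
models of the factors `S¹`. -/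
abbrev torusModel (n : ℕ) :
    ModelWithCorners ℝ (Fin n → EuclideanSpace ℝ (Fin 1))
      (ModelPi fun _ : Fin n => EuclideanSpace ℝ (Fin 1)) :=
  ModelWithCorners.pi fun _ : Fin n => 𝓡 1

/-- The (smooth) diffeomorphisms of the torus. -/
abbrev TorusDiffeo (n : ℕ) : Type :=
  Diffeomorph (torusModel n) (torusModel n) (Torus n) (Torus n) ∞

/-- Vector fields on the torus. -/
abbrev TorusVectorField (n : ℕ) : Type :=
  (p : Torus n) → TangentSpace (torusModel n) p

/-- The coordinate vector field `∂/∂θᵢ` for the global angular coordinates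
`p = (exp (i θ₁), …, exp (i θₙ))`: at `p` it is the velocity at `t = 0` of the curve that moves
the `i`-th angle of `p` with unit speed and fixes the other ones. -/
def coordField {n : ℕ} (i : Fin n) : TorusVectorField n := fun p =>
  mfderiv 𝓘(ℝ, ℝ) (torusModel n)
    (fun t : ℝ => (Function.update p i (p i * Circle.exp t) : Torus n)) 0 (1 : ℝ)

/-- The constant vector field `∑ aᵢ ∂/∂θᵢ`. -/
def constField {n : ℕ} (a : Fin n → ℝ) : TorusVectorField n := fun p =>
  ∑ i, a i • (coordField i p : TangentSpace (torusModel n) p)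

/-- The push-forward `R_* X = TR ∘ X ∘ R⁻¹` of a vector field by a diffeomorphism. -/
def pushforward {n : ℕ} (R : TorusDiffeo n) (X : TorusVectorField n) : TorusVectorField n := fun p =>
  mfderiv (torusModel n) (torusModel n) R (R.symm p) (X (R.symm p))

/-- A smooth (complete) flow `φ : ℝ × Tⁿ → Tⁿ`. -/
structure SmoothFlow (n : ℕ) where
  toFun : ℝ → Torus n → Torus n
  smooth : ContMDiff (𝓘(ℝ, ℝ).prod (torusModel n)) (torusModel n) ∞
    (fun x : ℝ × Torus n => toFun x.1 x.2)
  map_zero : ∀ p, toFun 0 p = p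
  map_add : ∀ s t p, toFun (s + t) p = toFun s (toFun t p)

/-- The vector field `X(p) = d/dt φ(t, p)` at `t = 0` that generates the flow `φ`. -/
def SmoothFlow.generator {n : ℕ} (φ : SmoothFlow n) : TorusVectorField n := fun p =>
  mfderiv 𝓘(ℝ, ℝ) (torusModel n) (fun t : ℝ => φ.toFun t p) 0 (1 : ℝ)

/-- `R` is a generalized symmetry of `φ` with multiplier `α`: `R_* X = α X`. -/
def SmoothFlow.IsMultiplier {n : ℕ} (φ : SmoothFlow n) (R : TorusDiffeo n) (α : ℝˣ) : Prop :=
  ∀ p, pushforward R φ.generator p = (α : ℝ) • φ.generator p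

/-- Smooth conjugacy of flows: `V_* X = Y` for some diffeomorphism `V`. -/
def SmoothFlow.SmoothlyConjugate {n : ℕ} (φ ψ : SmoothFlow n) : Prop :=
  ∃ V : TorusDiffeo n, ∀ p, pushforward V φ.generator p = ψ.generator p

/-- A flow is quasiperiodic if it is smoothly conjugate with a flow generated by a constant vector
field whose components are linearly independent over `ℚ`. -/
def SmoothFlow.IsQuasiperiodic {n : ℕ} (φ : SmoothFlow n) : Prop :=
  ∃ (ψ : SmoothFlow n) (b : Fin n → ℝ),
    LinearIndependent ℚ b ∧ ψ.generator = constField b ∧ φ.SmoothlyConjugate ψ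

theorem isMultiplier_iff {n : ℕ} (φ : SmoothFlow n) (R : TorusDiffeo n) (α : ℝˣ) :
    φ.IsMultiplier R α ↔ ∀ p, mfderiv (torusModel n) (torusModel n) R p (φ.generator p) =
      (α : ℝ) • φ.generator (R p) := by
  constructor
  · intro h p
    have := h (R p)
    unfold pushforward at this
    rwa [R.symm_apply_apply] at this
  · intro h p
    have := h (R.symm p)
    rw [R.apply_symm_apply] at this
    exact this

theorem isMultiplier_refl {n : ℕ} (φ : SmoothFlow n) :
    φ.IsMultiplier (Diffeomorph.refl (torusModel n) (Torus n) ∞) 1 := by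
  rw [isMultiplier_iff]
  intro p
  have h : mfderiv (torusModel n) (torusModel n)
      (Diffeomorph.refl (torusModel n) (Torus n) ∞) p
        = ContinuousLinearMap.id ℝ (TangentSpace (torusModel n) p) := mfderiv_id
  rw [h, Units.val_one]
  exact (one_smul ℝ (φ.generator p)).symm

theorem isMultiplier_trans {n : ℕ} {φ : SmoothFlow n} {R S : TorusDiffeo n} {α β : ℝˣ}
    (hR : φ.IsMultiplier R α) (hS : φ.IsMultiplier S β) :
    φ.IsMultiplier (S.trans R) (α * β) := by
  rw [isMultiplier_iff] at *
  intro p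
  have h : mfderiv (torusModel n) (torusModel n) (S.trans R) p (φ.generator p)
      = mfderiv (torusModel n) (torusModel n) R (S p)
        (mfderiv (torusModel n) (torusModel n) S p (φ.generator p)) :=
    congrArg (fun L => L (φ.generator p)) (mfderiv_comp p
      (R.mdifferentiable (by simp) (S p)) (S.mdifferentiable (by simp) p))
  refine h.trans ?_
  rw [hS p, map_smul, hR (S p), smul_smul, Units.val_mul, mul_comm]
  rfl

theorem isMultiplier_symm {n : ℕ} {φ : SmoothFlow n} {R : TorusDiffeo n} {α : ℝˣ}
    (hR : φ.IsMultiplier R α) : φ.IsMultiplier R.symm α⁻¹ := by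
  rw [isMultiplier_iff]
  intro p
  obtain ⟨q, rfl⟩ : ∃ q, R q = p := ⟨R.symm p, R.apply_symm_apply p⟩
  have h : mfderiv (torusModel n) (torusModel n) R.symm (R q)
      (mfderiv (torusModel n) (torusModel n) R q (φ.generator q)) = φ.generator q := by
    have h1 := mfderiv_comp q (R.symm.mdifferentiable (by simp) (R q))
      (R.mdifferentiable (by simp) q)
    have h2 : (R.symm ∘ R : Torus n → Torus n) = id := funext R.symm_apply_apply
    rw [h2, mfderiv_id] at h1
    exact (congrArg (fun L => L (φ.generator q)) h1).symm
  rw [(isMultiplier_iff φ R α).1 hR q, map_smul] at h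
  have key : ∀ u v : Fin n → EuclideanSpace ℝ (Fin 1),
      (α : ℝ) • u = v → u = ((α⁻¹ : ℝˣ) : ℝ) • v := by
    rintro u v rfl
    rw [smul_smul, Units.inv_mul, one_smul]
  rw [R.symm_apply_apply]
  exact key _ _ h

/-- The multiplier group of a flow: the multipliers of its generalized symmetries, as a subgroup of
the multiplicative group of the real numbers. -/
def SmoothFlow.multiplierGroup {n : ℕ} (φ : SmoothFlow n) : Subgroup ℝˣ where
  carrier := {α | ∃ R : TorusDiffeo n, φ.IsMultiplier R α}
  mul_mem' := by
    rintro α β ⟨R, hR⟩ ⟨S, hS⟩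
    exact ⟨S.trans R, isMultiplier_trans hR hS⟩
  one_mem' := ⟨_, isMultiplier_refl φ⟩
  inv_mem' := by
    rintro α ⟨R, hR⟩
    exact ⟨R.symm, isMultiplier_symm hR⟩

/-- The constant vector field `∑ aᵢ ∂/∂θᵢ` is `F`-algebraic, for a subfield `F` of `ℝ`, if for some
nonzero real `ϑ` the numbers `ϑ a₁, …, ϑ aₙ` form a basis of `F` over `ℚ`. (Then `F` is a number
field of degree `n`.) -/
def IsAlgebraicOver {n : ℕ} (a : Fin n → ℝ) (F : IntermediateField ℚ ℝ) : Prop :=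
  ∃ ϑ : ℝ, ϑ ≠ 0 ∧ ∃ b : Module.Basis (Fin n) ℚ F, ∀ i, (b i : ℝ) = ϑ * a i

/-- The group of units of the ring of integers of a subfield `F` of `ℝ`, as a subgroup of the
multiplicative group of the real numbers. -/
def unitGroup (F : IntermediateField ℚ ℝ) : Subgroup ℝˣ :=
  (Units.map ((algebraMap F ℝ).comp
    (algebraMap (NumberField.RingOfIntegers F) F)).toMonoidHom).range

end QuasiperiodicFlow

end

/-! A multiplier `α` with symmetry `R` turns each coordinate `pⱼ`, an eigenfunction of the flow with
eigenvalue `i aⱼ`, into the eigenfunction `pⱼ ∘ R` with eigenvalue `i α aⱼ`. Lifting `pⱼ ∘ R` to a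
real-valued function on the universal cover `ℝⁿ` of the torus, one gets an integral linear form plus
a periodic, hence bounded, function; comparing the growth along the line `ℝ a` shows that `α aⱼ` is
an integral combination of the `aᵢ`. So multiplication by `α`, and likewise by `α⁻¹`, preserves the
`ℤ`-span of the frequencies, which makes both of them algebraic integers of `F`. -/

namespace QuasiperiodicFlow

open scoped Manifold
open Submodule (span)

section MultiplicationOnSpan

theorem isIntegral_of_mul_mem_span {R A ι : Type*} [CommRing R] [CommRing A] [IsDomain A]
    [Algebra R A] [Finite ι] {a : ι → A} (ha : a ≠ 0) {α : A}
    (hα : ∀ j, α * a j ∈ span R (Set.range a)) : IsIntegral R α := by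
  obtain ⟨j, hj⟩ := Function.ne_iff.1 ha
  refine isIntegral_of_smul_mem_submodule (span R (Set.range a))
    ((Submodule.ne_bot_iff _).2 ⟨a j, Submodule.subset_span ⟨j, rfl⟩, hj⟩)
    (Submodule.fg_span (Set.finite_range a)) α ?_
  change span R (Set.range a) ≤ (span R (Set.range a)).comap (LinearMap.mulLeft R α)
  exact Submodule.span_le.2 (Set.range_subset_iff.2 hα)

theorem mem_of_mul_mem_span {L S ι : Type*} [Field L] [SetLike S L] [SubfieldClass S L] {F : S}
    {a : ι → L} (ha : a ≠ 0) {ϑ : L} (hϑ : ϑ ≠ 0) (hF : ∀ i, ϑ * a i ∈ F) {α : L}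
    (hα : ∀ j, α * a j ∈ span ℤ (Set.range a)) : α ∈ F := by
  obtain ⟨j, hj⟩ := Function.ne_iff.1 ha
  have hspan : ∀ x ∈ span ℤ (Set.range a), ϑ * x ∈ F := by
    change span ℤ (Set.range a) ≤
      (AddSubgroup.toIntSubmodule (AddSubgroup.ofClass F)).comap (LinearMap.mulLeft ℤ ϑ)
    exact Submodule.span_le.2 (Set.range_subset_iff.2 hF)
  have hquot : α = ϑ * (α * a j) / (ϑ * a j) := by
    rw [mul_left_comm, mul_div_cancel_right₀ _ (mul_ne_zero hϑ hj)]
  rw [hquot]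
  exact div_mem (hspan _ (hα j)) (hF j)

theorem mem_unitGroup_of_isIntegral {F : IntermediateField ℚ ℝ} {u : ℝˣ} (hF : (u : ℝ) ∈ F)
    (hu : IsIntegral ℤ (u : ℝ)) (hu' : IsIntegral ℤ ((u⁻¹ : ℝˣ) : ℝ)) : u ∈ unitGroup F := by
  have hF' : ((u⁻¹ : ℝˣ) : ℝ) ∈ F := by
    rw [Units.val_inv_eq_inv_val]
    exact inv_mem hF
  have hinj := (algebraMap F ℝ).injective
  let x : NumberField.RingOfIntegers F :=
    ⟨⟨u, hF⟩, (isIntegral_algebraMap_iff hinj).1 hu⟩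
  let y : NumberField.RingOfIntegers F :=
    ⟨⟨_, hF'⟩, (isIntegral_algebraMap_iff hinj).1 hu'⟩
  have hxy : x * y = 1 := NumberField.RingOfIntegers.ext (Subtype.ext u.mul_inv)
  exact ⟨⟨x, y, hxy, mul_comm x y ▸ hxy⟩, Units.ext rfl⟩

end MultiplicationOnSpan

section CircleLift

theorem exists_continuous_circleExp_lift {X : Type*} [TopologicalSpace X] [SimplyConnectedSpace X]
    [LocallyPathConnectedSpace X] {f : X → Circle} (hf : Continuous f) :
    ∃ r : X → ℝ, Continuous r ∧ ∀ x, Circle.exp (r x) = f x := by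
  obtain ⟨x₀⟩ : Nonempty X := inferInstance
  obtain ⟨θ₀, hθ₀⟩ := Circle.isAddQuotientCoveringMap_exp.surjective (f x₀)
  obtain ⟨r, ⟨-, hr⟩, -⟩ :=
    Circle.isCoveringMap_exp.existsUnique_continuousMap_lifts ⟨f, hf⟩ x₀ θ₀ hθ₀
  exact ⟨r, r.continuous, congrFun hr⟩

theorem eq_of_circleExp_eq {X : Type*} [TopologicalSpace X] [PreconnectedSpace X] {f g : X → ℝ}
    (hf : Continuous f) (hg : Continuous g) (h : ∀ x, Circle.exp (f x) = Circle.exp (g x))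
    (x₀ : X) (h₀ : f x₀ = g x₀) (x : X) : f x = g x :=
  congrFun (Circle.isCoveringMap_exp.eq_of_comp_eq hf hg (funext h) x₀ h₀) x

variable {ι : Type*}

theorem exists_circleExp_lift_add_single [DecidableEq ι] {g : (ι → Circle) → Circle}
    (hg : Continuous g) :
    ∃ (r : (ι → ℝ) → ℝ) (m : ι → ℤ), Continuous r ∧
      (∀ x, Circle.exp (r x) = g fun i => Circle.exp (x i)) ∧
      ∀ i x, r (x + Pi.single i (2 * Real.pi)) = r x + m i * (2 * Real.pi) := by
  obtain ⟨r, hr, hexp⟩ := exists_continuous_circleExp_lift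
    (f := fun x : ι → ℝ => g fun i => Circle.exp (x i)) (by fun_prop)
  have hshift : ∀ i x, Circle.exp (r (x + Pi.single i (2 * Real.pi))) = Circle.exp (r x) := by
    intro i x
    rw [hexp, hexp]
    congr 1 with j
    obtain rfl | hj := eq_or_ne j i
    · simp
    · simp [Pi.single_eq_of_ne hj]
  choose m hm using fun i => Circle.exp_eq_exp.1 (hshift i 0)
  refine ⟨r, m, hr, hexp, fun i => eq_of_circleExp_eq (by fun_prop) (by fun_prop) (fun x => ?_) 0
    (hm i)⟩
  rw [hshift, Circle.exp_eq_exp]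
  exact ⟨-m i, by push_cast; ring⟩

theorem exists_norm_le_of_periodic {E F : Type*} [NormedAddCommGroup E] [NormedSpace ℝ E]
    [SeminormedAddGroup F] [Finite ι] (b : Module.Basis ι ℝ E) {s : E → F} (hs : Continuous s)
    (hper : ∀ i, Function.Periodic s (b i)) : ∃ C, ∀ x, ‖s x‖ ≤ C := by
  have := Fintype.ofFinite ι
  have := b.finiteDimensional_of_finite
  have := FiniteDimensional.proper ℝ E
  obtain ⟨C, hC⟩ := (isCompact_closedBall (0 : E) (∑ i, ‖b i‖)).exists_bound_of_continuousOn
    hs.continuousOn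
  refine ⟨C, fun x => ?_⟩
  have hlattice : ∀ v ∈ span ℤ (Set.range b), Function.Periodic s v := fun v hv => by
    induction hv using Submodule.span_induction with
    | mem v hv => obtain ⟨i, rfl⟩ := hv; exact hper i
    | zero => exact fun x => by rw [add_zero]
    | add v w _ _ hv hw => exact hv.add_period hw
    | smul k v _ hv => exact hv.zsmul k
  have hfract : s (ZSpan.fract b x) = s x :=
    (hlattice _ (ZSpan.floor b x).2).sub_eq x
  rw [← hfract]
  exact hC _ (mem_closedBall_zero_iff.2 (ZSpan.norm_fract_le b x))

theorem eq_zero_of_forall_norm_add_mul_le {c d C : ℝ} (h : ∀ t : ℝ, ‖d + t * c‖ ≤ C) : c = 0 := by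
  by_contra hc
  have hC : d + (C - d + 1) / c * c ≤ C := (le_abs_self _).trans (h _)
  rw [div_mul_cancel₀ _ hc] at hC
  linarith

theorem mem_span_of_apply_circleExp_line [Finite ι] {g : (ι → Circle) → Circle}
    (hg : Continuous g) {a : ι → ℝ} {β : ℝ}
    (h : ∀ t : ℝ, g (fun i => Circle.exp (t * a i)) = g 1 * Circle.exp (t * β)) :
    β ∈ span ℤ (Set.range a) := by
  classical
  have := Fintype.ofFinite ι
  obtain ⟨r, m, hr, hexp, hshift⟩ := exists_circleExp_lift_add_single hg
  have hline : ∀ t : ℝ, r (t • a) = r 0 + t * β := by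
    refine eq_of_circleExp_eq (by fun_prop) (by fun_prop) (fun t => ?_) 0 (by simp)
    have h0 : (fun i => Circle.exp ((0 : ι → ℝ) i)) = 1 := funext fun _ => Circle.exp_zero
    rw [Circle.exp_add, hexp, hexp, h0]
    exact h t
  let b := (Pi.basisFun ℝ ι).isUnitSMul fun _ => Real.two_pi_pos.ne'.isUnit
  have hb : ∀ i, b i = Pi.single i (2 * Real.pi) := fun i => by
    simp [b, Module.Basis.isUnitSMul_apply, ← Pi.single_smul]
  obtain ⟨C, hC⟩ := exists_norm_le_of_periodic b (s := fun x => r x - ∑ i, m i * x i)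
    (by fun_prop) fun i x => by
      simp only [hb, hshift, Pi.add_apply, mul_add, Finset.sum_add_distrib, Pi.single_apply,
        mul_ite, mul_zero, Finset.sum_ite_eq', Finset.mem_univ, if_true]
      ring
  have hslope : β - ∑ i, m i * a i = 0 := by
    refine eq_zero_of_forall_norm_add_mul_le (d := r 0) (C := C) fun t => ?_
    have haffine : r 0 + t * (β - ∑ i, m i * a i) = r (t • a) - ∑ i, m i * (t • a) i := by
      simp only [hline, Pi.smul_apply, smul_eq_mul, mul_sub, Finset.mul_sum, mul_left_comm t]
      ring
    rw [haffine]
    exact hC (t • a)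
  refine (Submodule.mem_span_range_iff_exists_fun ℤ).2 ⟨m, ?_⟩
  simpa only [zsmul_eq_mul] using (sub_eq_zero.1 hslope).symm

end CircleLift

section Manifold

section Pi

variable {𝕜 ι : Type*} [NontriviallyNormedField 𝕜] [Fintype ι]
  {E : ι → Type*} [∀ i, NormedAddCommGroup (E i)] [∀ i, NormedSpace 𝕜 (E i)]
  {H : ι → Type*} [∀ i, TopologicalSpace (H i)] {I : ∀ i, ModelWithCorners 𝕜 (E i) (H i)}
  {M : ι → Type*} [∀ i, TopologicalSpace (M i)] [∀ i, ChartedSpace (H i) (M i)]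

theorem mdifferentiableAt_eval (p : ∀ i, M i) (j : ι) :
    MDifferentiableAt (ModelWithCorners.pi I) (I j) (fun q : ∀ i, M i => q j) p := by
  refine (mdifferentiableAt_iff _ _).2 ⟨(continuous_apply j).continuousAt, ?_⟩
  have hid := (mdifferentiableAt_iff _ _).1 (mdifferentiableAt_id (I := I j) (x := p j))
  have hproj : DifferentiableWithinAt 𝕜 (fun x : ∀ i, E i => x j)
      (Set.range (ModelWithCorners.pi I)) (extChartAt (ModelWithCorners.pi I) p p) :=
    (differentiableAt_pi.1 differentiableAt_id j).differentiableWithinAt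
  refine DifferentiableWithinAt.comp (g := writtenInExtChartAt (I j) (I j) (p j) id)
    (t := Set.range (I j)) (extChartAt (ModelWithCorners.pi I) p p) hid.2 hproj ?_
  rintro _ ⟨x, rfl⟩
  exact ⟨x j, rfl⟩

theorem mdifferentiableAt_pi_iff {E' : Type*} [NormedAddCommGroup E'] [NormedSpace 𝕜 E']
    {H' : Type*} [TopologicalSpace H'] {I' : ModelWithCorners 𝕜 E' H'} {M' : Type*}
    [TopologicalSpace M'] [ChartedSpace H' M'] {c : M' → ∀ i, M i} {x : M'} :
    MDifferentiableAt I' (ModelWithCorners.pi I) c x ↔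
      ∀ j, MDifferentiableAt I' (I j) (fun y => c y j) x := by
  exact ⟨fun h j => (mdifferentiableAt_eval (c x) j).comp x h, fun h =>
    (mdifferentiableAt_iff _ _).2 ⟨continuousAt_pi.2 fun j => (h j).continuousAt,
      differentiableWithinAt_pi.2 fun j => ((mdifferentiableAt_iff _ _).1 (h j)).2⟩⟩

end Pi

theorem hasDerivAt_comp_curve {𝕜 E H M F : Type*} [NontriviallyNormedField 𝕜]
    [NormedAddCommGroup E] [NormedSpace 𝕜 E] [TopologicalSpace H] {I : ModelWithCorners 𝕜 E H}
    [TopologicalSpace M] [ChartedSpace H M] [NormedAddCommGroup F] [NormedSpace 𝕜 F]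
    {f : M → F} {c : 𝕜 → M} {t : 𝕜} {p : M} (hc : MDifferentiableAt 𝓘(𝕜, 𝕜) I c t)
    (hp : c t = p) (hf : MDifferentiableAt I 𝓘(𝕜, F) f p) :
    HasDerivAt (fun s => f (c s))
      (mfderiv I 𝓘(𝕜, F) f p (mfderiv 𝓘(𝕜, 𝕜) I c t (1 : 𝕜))) t := by
  subst hp
  let D : 𝕜 →L[𝕜] F := (mfderiv I 𝓘(𝕜, F) f (c t)).comp (mfderiv 𝓘(𝕜, 𝕜) I c t)
  have h : HasFDerivAt (fun s => f (c s)) D t :=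
    (hf.hasMFDerivAt.comp t hc.hasMFDerivAt).hasFDerivAt
  exact h.hasDerivAt

theorem mdifferentiable_circleCoe : MDifferentiable (𝓡 1) 𝓘(ℝ, ℂ) (fun z : Circle => (z : ℂ)) := by
  have := finrank_real_complex_fact'
  exact (contMDiff_coe_sphere (m := 1) (E := ℂ) (n := 1)).mdifferentiable one_ne_zero

end Manifold

section DerivAlong

variable {n : ℕ} {F : Type*} [NormedAddCommGroup F] [NormedSpace ℝ F]

/-- The derivative `X f` of an observable `f` on the torus along a vector field `X`. Its values are
declared to lie in `F` itself instead of in the tangent spaces of `F`. -/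
noncomputable def derivAlong (X : TorusVectorField n) (f : Torus n → F) (p : Torus n) : F :=
  mfderiv (torusModel n) 𝓘(ℝ, F) f p (X p)

theorem derivAlong_constField (a : Fin n → ℝ) (f : Torus n → F) (p : Torus n) :
    derivAlong (constField a) f p = ∑ i, a i • derivAlong (coordField i) f p :=
  (map_sum (mfderiv (torusModel n) 𝓘(ℝ, F) f p) _ _).trans
    (Finset.sum_congr rfl fun _ _ => map_smul _ _ _)

theorem SmoothFlow.IsMultiplier.derivAlong_comp {φ : SmoothFlow n} {R : TorusDiffeo n} {α : ℝˣ}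
    (hR : φ.IsMultiplier R α) {f : Torus n → F} (hf : MDifferentiable (torusModel n) 𝓘(ℝ, F) f)
    (p : Torus n) :
    derivAlong φ.generator (f ∘ R) p = (α : ℝ) • derivAlong φ.generator f (R p) := by
  have hchain : derivAlong φ.generator (f ∘ R) p = mfderiv (torusModel n) 𝓘(ℝ, F) f (R p)
      (mfderiv (torusModel n) (torusModel n) R p (φ.generator p)) :=
    congrArg (fun L => L (φ.generator p))
      (mfderiv_comp p (hf (R p)) (R.mdifferentiable (by simp) p))
  rw [(isMultiplier_iff φ R α).1 hR p] at hchain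
  exact hchain.trans (map_smul _ _ _)

/-- The coordinate `pⱼ = exp (i θⱼ)` of a point of the torus, as a complex-valued observable. -/
def complexCoord (j : Fin n) (p : Torus n) : ℂ := p j

theorem mdifferentiable_complexCoord (j : Fin n) :
    MDifferentiable (torusModel n) 𝓘(ℝ, ℂ) (complexCoord j) := fun p =>
  (mdifferentiable_circleCoe (p j)).comp p (mdifferentiableAt_eval p j)

theorem mdifferentiable_update_mul_circleExp (p : Torus n) (i : Fin n) :
    MDifferentiable 𝓘(ℝ, ℝ) (torusModel n)
      (fun t : ℝ => (Function.update p i (p i * Circle.exp t) : Torus n)) := fun t => by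
  refine mdifferentiableAt_pi_iff.2 fun j => ?_
  obtain rfl | hj := eq_or_ne j i
  · simp only [Function.update_self]
    exact (contMDiff_const.mul (contMDiff_circleExp (m := 1))).mdifferentiable one_ne_zero t
  · simp only [Function.update_of_ne hj]
    exact mdifferentiableAt_const

theorem derivAlong_coordField_complexCoord (i j : Fin n) (p : Torus n) :
    derivAlong (coordField i) (complexCoord j) p
      = if j = i then Complex.I * complexCoord j p else 0 := by
  refine (hasDerivAt_comp_curve (mdifferentiable_update_mul_circleExp p i 0) (by simp)
    (mdifferentiable_complexCoord j p)).unique ?_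
  unfold complexCoord
  split_ifs with hj
  · subst hj
    have hexp : HasDerivAt (fun t : ℝ => (p j : ℂ) * Complex.exp (t * Complex.I)) _ 0 :=
      (((hasDerivAt_id ((0 : ℝ) : ℂ)).comp_ofReal.mul_const Complex.I).cexp).const_mul (p j : ℂ)
    simp only [Function.update_self, Circle.coe_mul, Circle.coe_exp]
    exact hexp.congr_deriv (by simp [mul_comm])
  · simp only [Function.update_of_ne hj]
    exact hasDerivAt_const _ _

theorem derivAlong_constField_complexCoord (a : Fin n → ℝ) (j : Fin n) (p : Torus n) :
    derivAlong (constField a) (complexCoord j) p = a j * Complex.I * complexCoord j p := by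
  simp only [derivAlong_constField, derivAlong_coordField_complexCoord, smul_ite, smul_zero,
    Finset.sum_ite_eq, Finset.mem_univ, if_true, Complex.real_smul, mul_assoc]

end DerivAlong

theorem eq_mul_cexp_of_hasDerivAt {z : ℝ → ℂ} {c : ℂ} (hz : ∀ t, HasDerivAt z (c * z t) t)
    (t : ℝ) : z t = z 0 * Complex.exp (t * c) := by
  have hexp : ∀ s : ℝ, HasDerivAt (fun u : ℝ => Complex.exp (-(u * c)))
      (Complex.exp (-(s * c)) * -(1 * c)) s := fun s =>
    ((hasDerivAt_id (s : ℂ)).comp_ofReal.mul_const c).neg.cexp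
  have hderiv : ∀ s : ℝ, HasDerivAt (fun u : ℝ => z u * Complex.exp (-(u * c))) 0 s := fun s =>
    ((hz s).mul (hexp s)).congr_deriv (by ring)
  have hconst := is_const_of_deriv_eq_zero (fun s => (hderiv s).differentiableAt)
    (fun s => (hderiv s).deriv) t 0
  rw [Complex.ofReal_zero, zero_mul, neg_zero, Complex.exp_zero, mul_one] at hconst
  rw [← hconst, mul_assoc, ← Complex.exp_add, neg_add_cancel, Complex.exp_zero, mul_one]

namespace SmoothFlow

variable {n : ℕ} {φ : SmoothFlow n}

theorem mdifferentiable_orbit (φ : SmoothFlow n) (p : Torus n) :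
    MDifferentiable 𝓘(ℝ, ℝ) (torusModel n) (fun t => φ.toFun t p) :=
  (φ.smooth.comp (contMDiff_id.prodMk contMDiff_const)).mdifferentiable (by simp)

theorem hasDerivAt_orbit (φ : SmoothFlow n) {F : Type*} [NormedAddCommGroup F] [NormedSpace ℝ F]
    {f : Torus n → F} (hf : MDifferentiable (torusModel n) 𝓘(ℝ, F) f) (p : Torus n) (t : ℝ) :
    HasDerivAt (fun s => f (φ.toFun s p)) (derivAlong φ.generator f (φ.toFun t p)) t := by
  have hzero : HasDerivAt (fun s => f (φ.toFun s (φ.toFun t p)))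
      (derivAlong φ.generator f (φ.toFun t p)) (t - t) := by
    rw [sub_self]
    exact hasDerivAt_comp_curve (φ.mdifferentiable_orbit (φ.toFun t p) 0) (φ.map_zero _)
      (hf (φ.toFun t p))
  simpa only [← φ.map_add, sub_add_cancel] using hzero.comp_sub_const t t

/-- `f` is a differentiable eigenfunction, with eigenvalue `c`, of the derivation along the
generator of `φ`. -/
structure IsEigenfunction (φ : SmoothFlow n) (f : Torus n → ℂ) (c : ℂ) : Prop where
  mdifferentiable : MDifferentiable (torusModel n) 𝓘(ℝ, ℂ) f
  derivAlong_generator : ∀ p, derivAlong φ.generator f p = c * f p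

theorem isEigenfunction_complexCoord {a : Fin n → ℝ} (hX : φ.generator = constField a)
    (j : Fin n) : φ.IsEigenfunction (complexCoord j) (a j * Complex.I) where
  mdifferentiable := mdifferentiable_complexCoord j
  derivAlong_generator p := by rw [hX, derivAlong_constField_complexCoord]

theorem IsEigenfunction.apply_toFun {f : Torus n → ℂ} {c : ℂ} (hf : φ.IsEigenfunction f c)
    (p : Torus n) (t : ℝ) : f (φ.toFun t p) = f p * Complex.exp (t * c) := by
  have h := eq_mul_cexp_of_hasDerivAt (z := fun s => f (φ.toFun s p)) (c := c) (fun s =>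
    (φ.hasDerivAt_orbit hf.mdifferentiable p s).congr_deriv (hf.derivAlong_generator _)) t
  rwa [φ.map_zero] at h

theorem IsEigenfunction.comp_of_isMultiplier {f : Torus n → ℂ} {c : ℂ}
    (hf : φ.IsEigenfunction f c) {R : TorusDiffeo n} {α : ℝˣ} (hR : φ.IsMultiplier R α) :
    φ.IsEigenfunction (f ∘ R) ((α : ℝ) * c) where
  mdifferentiable := hf.mdifferentiable.comp (R.mdifferentiable (by simp))
  derivAlong_generator p := by
    rw [hR.derivAlong_comp hf.mdifferentiable, hf.derivAlong_generator, Complex.real_smul,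
      ← mul_assoc, Function.comp_apply]

theorem IsMultiplier.apply_toFun {a : Fin n → ℝ} (hX : φ.generator = constField a)
    {R : TorusDiffeo n} {α : ℝˣ} (hR : φ.IsMultiplier R α) (p : Torus n) (t : ℝ) (j : Fin n) :
    R (φ.toFun t p) j = R p j * Circle.exp (t * (α * a j)) := by
  have h := ((isEigenfunction_complexCoord hX j).comp_of_isMultiplier hR).apply_toFun p t
  refine Circle.ext (h.trans ?_)
  simp [complexCoord, mul_assoc]

theorem toFun_apply {a : Fin n → ℝ} (hX : φ.generator = constField a) (t : ℝ) (p : Torus n)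
    (j : Fin n) : φ.toFun t p j = p j * Circle.exp (t * a j) := by
  simpa using (isMultiplier_refl φ).apply_toFun hX p t j

theorem mul_mem_span_of_mem_multiplierGroup {a : Fin n → ℝ} (hX : φ.generator = constField a)
    {α : ℝˣ} (hα : α ∈ φ.multiplierGroup) (j : Fin n) : α * a j ∈ span ℤ (Set.range a) := by
  obtain ⟨R, hR⟩ := hα
  refine mem_span_of_apply_circleExp_line (g := fun p => R p j)
    ((continuous_apply j).comp R.continuous) fun t => ?_
  have horbit : φ.toFun t 1 = fun i => Circle.exp (t * a i) := by
    funext i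
    rw [toFun_apply hX, Pi.one_apply, one_mul]
  rw [← hR.apply_toFun hX 1 t j, horbit]

end SmoothFlow

theorem IsAlgebraicOver.ne_zero {n : ℕ} {a : Fin n → ℝ} {F : IntermediateField ℚ ℝ}
    (hF : IsAlgebraicOver a F) : a ≠ 0 := by
  rintro rfl
  obtain ⟨ϑ, -, b, hb⟩ := hF
  obtain ⟨j⟩ := b.index_nonempty
  exact b.ne_zero j (Subtype.ext (by simp [hb]))

end QuasiperiodicFlow

theorem theorem3p4_general {n : ℕ} {φ : QuasiperiodicFlow.SmoothFlow n} {a : Fin n → ℝ}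
    (hX : φ.generator = QuasiperiodicFlow.constField a) (ha : a ≠ 0)
    {F : IntermediateField ℚ ℝ} {ϑ : ℝ} (hϑ : ϑ ≠ 0) (hF : ∀ i, ϑ * a i ∈ F) :
    φ.multiplierGroup ≤ QuasiperiodicFlow.unitGroup F := by
  intro α hα
  have hmul := QuasiperiodicFlow.SmoothFlow.mul_mem_span_of_mem_multiplierGroup hX hα
  have hinv := QuasiperiodicFlow.SmoothFlow.mul_mem_span_of_mem_multiplierGroup hX (inv_mem hα)
  exact QuasiperiodicFlow.mem_unitGroup_of_isIntegral
    (QuasiperiodicFlow.mem_of_mul_mem_span ha hϑ hF hmul)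
    (QuasiperiodicFlow.isIntegral_of_mul_mem_span ha hmul)
    (QuasiperiodicFlow.isIntegral_of_mul_mem_span ha hinv)

theorem theorem3p4 (n : ℕ) (φ : QuasiperiodicFlow.SmoothFlow n) (hφ : φ.IsQuasiperiodic)
    (a : Fin n → ℝ) (hX : φ.generator = QuasiperiodicFlow.constField a)
    (F : IntermediateField ℚ ℝ)
    (hF : QuasiperiodicFlow.IsAlgebraicOver a F) :
    φ.multiplierGroup ≤ QuasiperiodicFlow.unitGroup F := by
  have ⟨_, hϑ, b, hb⟩ := hF
  exact theorem3p4_general hX hF.ne_zero hϑ fun i => hb i ▸ (b i).2
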